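/- Let $\mu$ be a positive Radon measure on $[0,\infty)$ and let $n_0\ge 2$ be an integer such that $\int_{[0,\infty)} n_0^{-2\sigma}\,d\mu(\sigma)<\infty$; assume that $0$ belongs to the support of $\mu$. For $n\ge n_0$ put $$w_n=\int_{[0,\infty)} n^{-2\sigma}\,d\mu(\sigma),\qquad w^\flat_n=(\log n)^2\,w_n .$$ For a sequence $v=(v_n)_{n\ge n_0}$ of positive weights (here $v=w$ or $v=w^\flat$), let $\mathcal H_v$ be the Hilbert space of functions on the half-plane $\Omega_{1/2}=\{s\in\mathbb C:\operatorname{Re}s>1/2\}$ of the form $$f(s)=\sum_{n\ge n_0}a_n n^{-s},\qquad \|f\|_{\mathcal H_v}^2=\sum_{n\ge n_0}|a_n|^2v_n<\infty ,$$ where the Dirichlet series converges absolutely in $\Omega_{1/2}$ (for $v=w$ and $v=w^\flat$ this is automatic when $\sum|a_n|^2v_n<\infty$). A multiplier of $\mathcal H_v$ is a function $\varphi:\Omega_{1/2}\to\mathbb C$ such that $\varphi f\in\mathcal H_v$ for every $f\in\mathcal H_v$; its multiplier norm on $\mathcal H_v$ is the operator norm of $f\mapsto\varphi f$ on $\mathcal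 H_v$. Then every multiplier $\varphi$ of $\mathcal H_{w^\flat}$ is a multiplier of $\mathcal H_w$, its multiplier norm on $\mathcal H_{w^\flat}$ is finite, and its multiplier norm on $\mathcal H_w$ is at most its multiplier norm on $\mathcal H_{w^\flat}$. -/

import Mathlib

open MeasureTheory
open scoped NNReal ENNReal

noncomputable section

namespace DirichletHilbert

/-- The open half-plane `Ω_ρ = {s : Re s > ρ}`. -/
def halfPlane (ρ : ℝ) : Set ℂ := {s | ρ < s.re}

/-- The Dirichlet series `∑ aₙ n^{-s}` (sum over `n ≥ 1`) converges unconditionally to `f s` at every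
point `s` of `Ω_{1/2}`. The normalization `a 0 = 0` makes `a` unique. -/
def IsRepresentedBy (f : halfPlane (1 / 2) → ℂ) (a : ℕ → ℂ) : Prop :=
  a 0 = 0 ∧ ∀ s : halfPlane (1 / 2), LSeriesHasSum a (s : ℂ) (f s)

/-- The Dirichlet coefficients of a function on `Ω_{1/2}` represented by a Dirichlet series are
uniquely determined. -/
theorem IsRepresentedBy.unique {f : halfPlane (1 / 2) → ℂ} {a b : ℕ → ℂ}
    (ha : IsRepresentedBy f a) (hb : IsRepresentedBy f b) : a = b := by
  have key : ∀ {c : ℕ → ℂ}, IsRepresentedBy f c → LSeries.abscissaOfAbsConv c < ⊤ := by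
    intro c hc
    have h1 : (1 : ℂ) ∈ halfPlane (1 / 2) := by
      change (1 / 2 : ℝ) < (1 : ℂ).re; norm_num
    exact (hc.2 ⟨1, h1⟩).LSeriesSummable.abscissaOfAbsConv_le.trans_lt (EReal.coe_lt_top _)
  funext n
  rcases eq_or_ne n 0 with rfl | hn
  · rw [ha.1, hb.1]
  · refine LSeries.eq_of_LSeries_eventually_eq (key ha) (key hb) ?_ hn
    filter_upwards [Filter.eventually_gt_atTop (1 / 2 : ℝ)] with x hx
    have hx' : (x : ℂ) ∈ halfPlane (1 / 2) := by simpa [halfPlane] using hx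
    exact (ha.2 ⟨x, hx'⟩).LSeries_eq.trans (hb.2 ⟨x, hx'⟩).LSeries_eq.symm

open Classical in
/-- The sequence of Dirichlet coefficients of `f` (zero if `f` is not represented by a Dirichlet
series on `Ω_{1/2}`). -/
def coeff (f : halfPlane (1 / 2) → ℂ) : ℕ → ℂ :=
  if h : ∃ a, IsRepresentedBy f a then h.choose else 0

theorem IsRepresentedBy.coeff_eq {f : halfPlane (1 / 2) → ℂ} {a : ℕ → ℂ}
    (ha : IsRepresentedBy f a) : coeff f = a := by
  have h : ∃ a, IsRepresentedBy f a := ⟨a, ha⟩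
  rw [coeff, dif_pos h]
  exact h.choose_spec.unique ha

/-- The space `H_w` of functions `f(s) = ∑_{n ≥ n₀} aₙ n^{-s}` with `∑_{n ≥ n₀} |aₙ|² wₙ < ∞`.
Only the values `w n` with `n ≥ n₀` matter. -/
def space (n₀ : ℕ) (w : ℕ → ℝ) : Set (halfPlane (1 / 2) → ℂ) :=
  {f | ∃ a : ℕ → ℂ, IsRepresentedBy f a ∧ (∀ n < n₀, a n = 0) ∧
    Summable fun n => ‖a n‖ ^ 2 * w n}

/-- The norm of `H_w`: `‖f‖² = ∑ₙ |aₙ|² wₙ`, where `a` is the coefficient sequence of `f`. -/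
def spaceNorm (w : ℕ → ℝ) (f : halfPlane (1 / 2) → ℂ) : ℝ :=
  Real.sqrt (∑' n, ‖coeff f n‖ ^ 2 * w n)

/-- `φ` is a multiplier of `H_w`: `φ f ∈ H_w` for every `f ∈ H_w`. -/
def IsMultiplier (n₀ : ℕ) (w : ℕ → ℝ) (φ : halfPlane (1 / 2) → ℂ) : Prop :=
  ∀ f ∈ space n₀ w, φ * f ∈ space n₀ w

/-- The operator norm of the multiplication operator `f ↦ φ f` on `H_w` (for a multiplier `φ`):
the infimum of all `C ≥ 0` with `‖φ f‖ ≤ C ‖f‖` for all `f ∈ H_w`; it is `∞` if there is no such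
`C`. -/
def multiplierNorm (n₀ : ℕ) (w : ℕ → ℝ) (φ : halfPlane (1 / 2) → ℂ) : ℝ≥0∞ :=
  ⨅ (C : ℝ≥0) (_ : ∀ f ∈ space n₀ w, spaceNorm w (φ * f) ≤ C * spaceNorm w f), (C : ℝ≥0∞)

/-- The moments `wₙ = ∫_{[0,∞)} n^{-2σ} dμ(σ)`. -/
def weight (μ : Measure ℝ≥0) (n : ℕ) : ℝ :=
  ∫ σ : ℝ≥0, (n : ℝ) ^ (-2 * (σ : ℝ)) ∂μ

/-- The weights `w♭ₙ = (log n)² wₙ`. -/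
def weightFlat (μ : Measure ℝ≥0) (n : ℕ) : ℝ :=
  Real.log n ^ 2 * weight μ n

end DirichletHilbert

end

namespace DirichletHilbert

open Filter Topology
open scoped LSeries.notation

/-! Both weights are compared with the unweighted problem. Let `c` be the Dirichlet coefficients of
`φ`, and let `C` bound multiplication by `φ` for the weights `(log n)² wₙ`. Test this bound on
`K^{-s} P(s)`, where `P` is a truncation of `f` to indices `n < N`. The weights then involved are
`(log Kn)² w_{Kn}`. Since `w` is antitone, for `n < N` they lie between `(log K)² w_{KN}` and `(log
KN)² w_K`.

These two bounds have ratio arbitrarily near 1 along suitable `K`. Otherwise `u = w / log²` would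
shrink by a fixed factor at every step `K ↦ KN`, hence decay like a power, while `0 ∈ supp μ` forces
`wₙ ≥ c n^{-ε}` for every `ε > 0` (`weight_lower_bound`, `not_contraction_of_subpolynomial`). So
`∑_{n<N} |(c ⍟ a)ₙ|² ≤ C² ∑_{n<N} |aₙ|²` for every `N` (`partialSums_convolution_le`), and Abel
summation against the antitone `w` gives the bound `C` on `H_w`.

Finiteness of the norm on `H_{w♭}` is the closed graph theorem (`exists_convolution_bound`). -/

/-! ### Dilations and products of Dirichlet series -/

/-- The coefficients of `K^{-s} f(s)`, where `a` is the coefficient sequence of `f`. -/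
def dilate (K : ℕ) (a : ℕ → ℂ) (n : ℕ) : ℂ := if K ∣ n then a (n / K) else 0

@[simp]
theorem dilate_mul {K : ℕ} (hK : K ≠ 0) (a : ℕ → ℂ) (n : ℕ) : dilate K a (K * n) = a n := by
  simp [dilate, Nat.mul_div_cancel_left n (Nat.pos_of_ne_zero hK)]

theorem dilate_of_not_dvd {K n : ℕ} (h : ¬ K ∣ n) (a : ℕ → ℂ) : dilate K a n = 0 := by
  simp [dilate, h]

theorem hasSum_comp_dilate {α : Type*} [AddCommMonoid α] [TopologicalSpace α] {K : ℕ}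
    (hK : K ≠ 0) (g : ℕ → α) (hg : ∀ n, ¬ K ∣ n → g n = 0) {x : α} :
    HasSum (fun n => g (K * n)) x ↔ HasSum g x := by
  refine (Function.Injective.hasSum_iff (g := fun n => K * n)
    (fun m n h => Nat.eq_of_mul_eq_mul_left (Nat.pos_of_ne_zero hK) h) ?_)
  intro n hn
  exact hg n fun ⟨m, hm⟩ => hn ⟨m, hm.symm⟩

theorem lseriesHasSum_dilate {K : ℕ} (hK : K ≠ 0) {a : ℕ → ℂ} {s x : ℂ} :
    LSeriesHasSum (dilate K a) s ((K : ℂ) ^ (-s) * x) ↔ LSeriesHasSum a s x := by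
  have hKC : (K : ℂ) ≠ 0 := by exact_mod_cast hK
  have hne : (K : ℂ) ^ (-s) ≠ 0 := by simp [Complex.cpow_eq_zero_iff, hKC]
  rw [LSeriesHasSum, LSeriesHasSum, ← hasSum_comp_dilate hK]
  · have key : ∀ n, LSeries.term (dilate K a) s (K * n) = (K : ℂ) ^ (-s) * LSeries.term a s n := by
      intro n
      rcases eq_or_ne n 0 with rfl | hn
      · simp
      · rw [LSeries.term_of_ne_zero (mul_ne_zero hK hn), LSeries.term_of_ne_zero hn,
          dilate_mul hK, Nat.cast_mul, Complex.natCast_mul_natCast_cpow, Complex.cpow_neg]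
        field_simp
    simp only [key]
    exact hasSum_mul_left_iff hne
  · intro n hn
    have h0 : n ≠ 0 := by rintro rfl; exact hn (dvd_zero K)
    rw [LSeries.term_of_ne_zero h0, dilate_of_not_dvd hn, zero_div]

/-- The function `s ↦ K^{-s}` on `Ω_{1/2}`. -/
noncomputable def npowNeg (K : ℕ) : halfPlane (1 / 2) → ℂ := fun s => (K : ℂ) ^ (-(s : ℂ))

theorem isRepresentedBy_dilate {K : ℕ} (hK : K ≠ 0) {f : halfPlane (1 / 2) → ℂ} {a : ℕ → ℂ} :
    IsRepresentedBy (npowNeg K * f) (dilate K a) ↔ IsRepresentedBy f a := by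
  refine and_congr (by simp [dilate]) (forall_congr' fun s => ?_)
  exact lseriesHasSum_dilate hK

theorem IsRepresentedBy.mul {f g : halfPlane (1 / 2) → ℂ} {a b : ℕ → ℂ}
    (ha : IsRepresentedBy f a) (hb : IsRepresentedBy g b) : IsRepresentedBy (f * g) (a ⍟ b) :=
  ⟨by simp, fun s => (ha.2 s).convolution (hb.2 s)⟩

theorem isRepresentedBy_one : IsRepresentedBy 1 LSeries.delta := by
  refine ⟨by simp [LSeries.delta], fun s => ?_⟩
  rw [LSeriesHasSum, funext (LSeries.term_delta (s : ℂ))]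
  exact hasSum_ite_eq (1 : ℕ) (1 : ℂ)

theorem isRepresentedBy_npowNeg {K : ℕ} (hK : K ≠ 0) :
    IsRepresentedBy (npowNeg K) (dilate K LSeries.delta) := by
  simpa using (isRepresentedBy_dilate hK).2 isRepresentedBy_one

/-- If `K^{-s} φ` and `(K+1)^{-s} φ` are Dirichlet series, so is `φ`. -/
theorem exists_isRepresentedBy_of_npowNeg_mul {K : ℕ} (hK : K ≠ 0) {φ : halfPlane (1 / 2) → ℂ}
    {b b' : ℕ → ℂ} (hb : IsRepresentedBy (npowNeg K * φ) b)
    (hb' : IsRepresentedBy (npowNeg (K + 1) * φ) b') : ∃ c, IsRepresentedBy φ c := by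
  have h1 := (isRepresentedBy_dilate (Nat.succ_ne_zero K)).2 hb
  have h2 := (isRepresentedBy_dilate hK).2 hb'
  rw [mul_left_comm] at h1
  have heq : dilate (K + 1) b = dilate K b' := h1.unique h2
  refine ⟨fun n => b (K * n), (isRepresentedBy_dilate hK).1 ?_⟩
  convert hb using 1
  funext n
  by_cases hn : K ∣ n
  · obtain ⟨m, rfl⟩ := hn
    rw [dilate_mul hK]
  -- `b n` is the coefficient of `K^{-s} (K+1)^{-s} φ` at `(K+1)n`. It vanishes if `K ∤ n`, because
  -- `K` and `K+1` are coprime.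
  · rw [dilate_of_not_dvd hn, ← dilate_mul (Nat.succ_ne_zero K) b n, heq, dilate_of_not_dvd]
    intro h
    exact hn ((Nat.Coprime.dvd_mul_left (by simp)).1 h)

/-! ### Abel summation and subpolynomial decay -/

/-- Domination of the partial sums passes to sums with antitone weights. -/
theorem mul_sum_le_sum_mul_of_antitone {z W : ℕ → ℝ} (hW : Antitone W)
    (hz : ∀ N, 0 ≤ ∑ n ∈ Finset.range N, z n) (N : ℕ) :
    W N * ∑ n ∈ Finset.range N, z n ≤ ∑ n ∈ Finset.range N, z n * W n := by
  induction N with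
  | zero => simp
  | succ N ih =>
    have h := mul_le_mul_of_nonneg_right (hW (Nat.le_succ N)) (hz (N + 1))
    rw [Finset.sum_range_succ] at h ⊢
    rw [Finset.sum_range_succ]
    nlinarith

theorem summable_and_tsum_le_of_partialSums_le {x y W : ℕ → ℝ} (hW : Antitone W)
    (hW0 : ∀ n, 0 ≤ W n) (hx : ∀ n, 0 ≤ x n) (hy : ∀ n, 0 ≤ y n)
    (h : ∀ N, ∑ n ∈ Finset.range N, x n ≤ ∑ n ∈ Finset.range N, y n)
    (hs : Summable fun n => y n * W n) :
    (Summable fun n => x n * W n) ∧ ∑' n, x n * W n ≤ ∑' n, y n * W n := by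
  have hle : ∀ N, ∑ n ∈ Finset.range N, x n * W n ≤ ∑' n, y n * W n := by
    intro N
    refine le_trans ?_ (hs.sum_le_tsum (Finset.range N) fun n _ => mul_nonneg (hy n) (hW0 n))
    have hz : ∀ N, 0 ≤ ∑ n ∈ Finset.range N, (y n - x n) := fun N => by
      rw [Finset.sum_sub_distrib]; linarith [h N]
    have := (mul_nonneg (hW0 N) (hz N)).trans (mul_sum_le_sum_mul_of_antitone hW hz N)
    simp only [sub_mul, Finset.sum_sub_distrib] at this
    linarith
  have hx0 : ∀ n, 0 ≤ x n * W n := fun n => mul_nonneg (hx n) (hW0 n)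
  exact ⟨summable_of_sum_range_le hx0 hle, Real.tsum_le_of_sum_range_le hx0 hle⟩

/-- A sequence with `u (K * N) ≤ q * u K`, `q < 1`, decays like a power. -/
theorem not_contraction_of_subpolynomial {u : ℕ → ℝ} {n₀ N : ℕ} (hn₀ : 1 ≤ n₀) (hN : 1 ≤ N)
    (hlow : ∀ ε > (0 : ℝ), ∃ c > (0 : ℝ), ∀ n ≥ n₀, c * (n : ℝ) ^ (-ε) ≤ u n) {A B : ℝ} (hB : 0 ≤ B)
    (h : ∀ K ≥ n₀, A * u (K * N) ≤ B * u K) : A ≤ B := by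
  by_contra! hAB
  have hA : 0 < A := hB.trans_lt hAB
  set q := B / A with hq
  have hq0 : 0 ≤ q := by positivity
  have hq1 : q < 1 := (div_lt_one hA).2 hAB
  have hNr : (0 : ℝ) < N := by exact_mod_cast hN
  -- `N^{-ε} → 1` as `ε → 0⁺`, so some power decays more slowly than the geometric rate `q < 1`
  -- along `n₀ N^j`.
  obtain ⟨ε, hεq, hε⟩ : ∃ ε : ℝ, q < (N : ℝ) ^ (-ε) ∧ 0 < ε := by
    have hc : Tendsto (fun ε : ℝ => (N : ℝ) ^ (-ε)) (𝓝[>] 0) (𝓝 1) := by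
      have : Continuous fun ε : ℝ => (N : ℝ) ^ (-ε) :=
        Continuous.rpow continuous_const continuous_neg fun _ => Or.inl hNr.ne'
      simpa using (this.tendsto 0).mono_left nhdsWithin_le_nhds
    exact ((hc.eventually (lt_mem_nhds hq1)).and self_mem_nhdsWithin).exists
  set r := (N : ℝ) ^ (-ε) with hr
  have hr0 : 0 < r := hq0.trans_lt hεq
  obtain ⟨c, hc, hcl⟩ := hlow ε hε
  have hup : ∀ j : ℕ, u (n₀ * N ^ j) ≤ q ^ j * u n₀ := by
    intro j
    induction j with
    | zero => simp
    | succ j ih =>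
      have h1 := h (n₀ * N ^ j) (Nat.le_mul_of_pos_right _ (by positivity))
      have h2 : u (n₀ * N ^ (j + 1)) ≤ q * u (n₀ * N ^ j) := by
        rw [hq, div_mul_eq_mul_div, le_div_iff₀ hA, pow_succ, ← mul_assoc]
        linarith
      calc _ ≤ _ := h2
        _ ≤ q * (q ^ j * u n₀) := by gcongr
        _ = _ := by ring
  have hdn : ∀ j : ℕ, c * (n₀ : ℝ) ^ (-ε) ≤ (q / r) ^ j * u n₀ := by
    intro j
    have h1 := (hcl (n₀ * N ^ j) (Nat.le_mul_of_pos_right _ (by positivity))).trans (hup j)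
    have h2 : ((n₀ * N ^ j : ℕ) : ℝ) ^ (-ε) = (n₀ : ℝ) ^ (-ε) * r ^ j := by
      rw [Nat.cast_mul, Real.mul_rpow (by positivity) (by positivity), Nat.cast_pow, hr,
        ← Real.rpow_natCast, ← Real.rpow_natCast, ← Real.rpow_mul hNr.le, ← Real.rpow_mul hNr.le,
        mul_comm (j : ℝ)]
    rw [h2, ← mul_assoc] at h1
    rw [div_pow, div_mul_eq_mul_div, le_div_iff₀ (by positivity)]
    exact h1
  have hlim : Tendsto (fun j : ℕ => (q / r) ^ j * u n₀) atTop (𝓝 0) := by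
    simpa using (tendsto_pow_atTop_nhds_zero_of_lt_one (by positivity)
      ((div_lt_one hr0).2 hεq)).mul_const (u n₀)
  have := ge_of_tendsto' hlim hdn
  have h0 : (0 : ℝ) < n₀ := by exact_mod_cast hn₀
  have : 0 < c * (n₀ : ℝ) ^ (-ε) := by positivity
  linarith

/-! ### Absolute convergence and norms through coefficients -/

/-- Cauchy–Schwarz in its termwise form: `|aₙ| n^{-σ} ≤ |aₙ|² wₙ + n^{-2σ} / wₙ`. The choice `ε = σ
- 1/2` bounds the last term by a multiple of `n^{-(σ+1/2)}`, whose exponent exceeds 1 in absolute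
value. -/
theorem lseriesSummable_of_summable {n₀ : ℕ} {w : ℕ → ℝ} (hn₀ : 1 ≤ n₀)
    (hlow : ∀ ε > (0 : ℝ), ∃ c > (0 : ℝ), ∀ n ≥ n₀, c * (n : ℝ) ^ (-ε) ≤ w n) {a : ℕ → ℂ}
    (h0 : ∀ n < n₀, a n = 0) (hs : Summable fun n => ‖a n‖ ^ 2 * w n) {s : ℂ}
    (hre : 1 / 2 < s.re) : LSeriesSummable a s := by
  obtain ⟨c, hc, hcw⟩ := hlow (s.re - 1 / 2) (by linarith)
  have h2 : Summable fun n : ℕ => c⁻¹ * (n : ℝ) ^ (-(s.re + 1 / 2)) :=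
    (Real.summable_nat_rpow.2 (by linarith)).mul_left _
  refine Summable.of_norm_bounded (hs.add h2) fun n => ?_
  rcases lt_or_ge n n₀ with hn | hn
  · have : LSeries.term a s n = 0 := by
      rcases eq_or_ne n 0 with rfl | hn'
      · simp
      · simp [LSeries.term_of_ne_zero hn', h0 n hn]
    rw [this, norm_zero, h0 n hn]
    simp only [norm_zero, ne_eq, OfNat.ofNat_ne_zero, not_false_eq_true, zero_pow, zero_mul,
      zero_add]
    positivity
  · have hn1 : n ≠ 0 := by omega
    have hnr : (0 : ℝ) < n := by exact_mod_cast Nat.pos_of_ne_zero hn1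
    have hw := hcw n hn
    have hv : 0 < c * (n : ℝ) ^ (-(s.re - 1 / 2)) := by positivity
    have hwp : 0 < w n := hv.trans_le hw
    rw [LSeries.norm_term_eq, if_neg hn1, div_eq_mul_inv, ← Real.rpow_neg hnr.le]
    set t := (n : ℝ) ^ (-s.re) with ht
    have htt : c⁻¹ * (n : ℝ) ^ (-(s.re + 1 / 2)) = t ^ 2 / (c * (n : ℝ) ^ (-(s.re - 1 / 2))) := by
      rw [eq_div_iff hv.ne', ht, ← Real.rpow_natCast, ← Real.rpow_mul hnr.le,
        mul_mul_mul_comm, inv_mul_cancel₀ hc.ne', one_mul, ← Real.rpow_add hnr]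
      congr 1
      push_cast
      ring
    have h3 : t ^ 2 / w n ≤ c⁻¹ * (n : ℝ) ^ (-(s.re + 1 / 2)) := by
      rw [htt]; gcongr
    have h4 : ‖a n‖ * t ≤ ‖a n‖ ^ 2 * w n + t ^ 2 / w n := by
      rw [← sub_nonneg]
      have : ‖a n‖ ^ 2 * w n + t ^ 2 / w n - ‖a n‖ * t
          = ((‖a n‖ * w n - t / 2) ^ 2 + 3 / 4 * t ^ 2) / w n := by field_simp; ring
      rw [this]; positivity
    linarith

theorem exists_mem_space_of_summable {n₀ : ℕ} {w : ℕ → ℝ} (hn₀ : 1 ≤ n₀)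
    (hlow : ∀ ε > (0 : ℝ), ∃ c > (0 : ℝ), ∀ n ≥ n₀, c * (n : ℝ) ^ (-ε) ≤ w n) {a : ℕ → ℂ}
    (h0 : ∀ n < n₀, a n = 0) (hs : Summable fun n => ‖a n‖ ^ 2 * w n) :
    ∃ f ∈ space n₀ w, IsRepresentedBy f a := by
  have h : IsRepresentedBy (fun s => LSeries a s) a :=
    ⟨h0 0 hn₀, fun s => (lseriesSummable_of_summable hn₀ hlow h0 hs s.2).LSeriesHasSum⟩
  exact ⟨_, ⟨a, h, h0, hs⟩, h⟩

theorem IsRepresentedBy.spaceNorm_eq {f : halfPlane (1 / 2) → ℂ} {a : ℕ → ℂ}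
    (ha : IsRepresentedBy f a) (w : ℕ → ℝ) :
    spaceNorm w f = Real.sqrt (∑' n, ‖a n‖ ^ 2 * w n) := by
  rw [spaceNorm, ha.coeff_eq]

theorem IsRepresentedBy.mem_space_iff {n₀ : ℕ} {w : ℕ → ℝ} {f : halfPlane (1 / 2) → ℂ} {a : ℕ → ℂ}
    (ha : IsRepresentedBy f a) :
    f ∈ space n₀ w ↔ (∀ n < n₀, a n = 0) ∧ Summable fun n => ‖a n‖ ^ 2 * w n := by
  constructor
  · rintro ⟨b, hb, h⟩
    rwa [ha.unique hb]
  · exact fun h => ⟨a, ha, h⟩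

theorem spaceNorm_le_iff {w : ℕ → ℝ} (hw : ∀ n, 0 ≤ w n) {f g : halfPlane (1 / 2) → ℂ}
    {a b : ℕ → ℂ} (ha : IsRepresentedBy f a) (hb : IsRepresentedBy g b) {C : ℝ} (hC : 0 ≤ C) :
    spaceNorm w g ≤ C * spaceNorm w f ↔
      ∑' n, ‖b n‖ ^ 2 * w n ≤ C ^ 2 * ∑' n, ‖a n‖ ^ 2 * w n := by
  have h : 0 ≤ ∑' n, ‖a n‖ ^ 2 * w n := tsum_nonneg fun n => mul_nonneg (by positivity) (hw n)
  rw [ha.spaceNorm_eq, hb.spaceNorm_eq, Real.sqrt_le_left (by positivity), mul_pow,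
    Real.sq_sqrt h]

/-! ### Automatic boundedness of multipliers -/

/-- A convolution operator that maps a weighted `ℓ²` space into itself is bounded. -/
theorem exists_convolution_bound {n₀ : ℕ} {w : ℕ → ℝ} (hw0 : ∀ n, 0 ≤ w n)
    (hw : ∀ n ≥ n₀, 0 < w n) {c : ℕ → ℂ}
    (hc : ∀ a : ℕ → ℂ, (∀ n < n₀, a n = 0) → (Summable fun n => ‖a n‖ ^ 2 * w n) →
      Summable fun n => ‖(c ⍟ a) n‖ ^ 2 * w n) :
    ∃ C : ℝ≥0, ∀ a : ℕ → ℂ, (∀ n < n₀, a n = 0) → (Summable fun n => ‖a n‖ ^ 2 * w n) →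
      ∑' n, ‖(c ⍟ a) n‖ ^ 2 * w n ≤ (C : ℝ) ^ 2 * ∑' n, ‖a n‖ ^ 2 * w n := by
  let E := lp (fun _ : ℕ => ℂ) 2
  have hp : 0 < (2 : ℝ≥0∞).toReal := by simp
  have hnorm : ∀ x : E, ‖x‖ ^ 2 = ∑' n, ‖x n‖ ^ 2 := fun x => by
    simpa using lp.norm_rpow_eq_tsum hp x
  have hmem : ∀ x : ℕ → ℂ, Memℓp x 2 ↔ Summable fun n => ‖x n‖ ^ 2 := fun x => by
    simpa using memℓp_gen_iff (f := x) hp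
  have hsq : ∀ (a : ℂ) (n : ℕ), ‖(Real.sqrt (w n) : ℂ) * a‖ ^ 2 = ‖a‖ ^ 2 * w n := fun a n => by
    rw [norm_mul, mul_pow, Complex.norm_real, Real.norm_of_nonneg (Real.sqrt_nonneg _),
      Real.sq_sqrt (hw0 n), mul_comm]
  -- Inverse of the isometry `a ↦ √w · a` into `ℓ²`; it is cut off below `n₀`, where `w` may vanish.
  let A : (ℕ → ℂ) → ℕ → ℂ := fun x n => if n < n₀ then 0 else x n / (Real.sqrt (w n) : ℂ)
  have hA0 : ∀ x, ∀ n < n₀, A x n = 0 := fun x n hn => if_pos hn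
  have hAs : ∀ x : E, Summable fun n => ‖A x n‖ ^ 2 * w n := fun x => by
    refine Summable.of_nonneg_of_le (fun n => mul_nonneg (by positivity) (hw0 n)) (fun n => ?_)
      ((hmem x).1 x.2)
    rw [← hsq]
    by_cases hn : n < n₀
    · rw [hA0 x n hn]; simp
    · have : (Real.sqrt (w n) : ℂ) ≠ 0 := by
        exact_mod_cast (Real.sqrt_pos.2 (hw n (not_lt.1 hn))).ne'
      simp only [A, if_neg hn]
      rw [mul_div_cancel₀ _ this]
  let T : E →ₗ[ℂ] E :=
    { toFun := fun x => ⟨fun n => (Real.sqrt (w n) : ℂ) * (c ⍟ A x) n, (hmem _).2 (by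
        simpa only [hsq] using hc _ (hA0 x) (hAs x))⟩
      map_add' := fun x y => by
        have : A (⇑(x + y)) = A x + A y := by
          funext n
          by_cases hn : n < n₀ <;> simp [A, hn, add_div]
        ext n
        change (Real.sqrt (w n) : ℂ) * (c ⍟ A (⇑(x + y))) n =
          (Real.sqrt (w n) : ℂ) * (c ⍟ A x) n + (Real.sqrt (w n) : ℂ) * (c ⍟ A y) n
        rw [this]
        simp only [LSeries.convolution_def, Pi.add_apply, mul_add, Finset.sum_add_distrib]
      map_smul' := fun k x => by
        have : A (⇑(k • x)) = k • A x := by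
          funext n
          by_cases hn : n < n₀
          · simp [A, hn]
          · simp only [A, if_neg hn, Pi.smul_apply, smul_eq_mul]
            exact mul_div_assoc k (x n) _
        ext n
        change (Real.sqrt (w n) : ℂ) * (c ⍟ A (⇑(k • x))) n =
          k * ((Real.sqrt (w n) : ℂ) * (c ⍟ A x) n)
        rw [this]
        simp only [LSeries.convolution_def, Pi.smul_apply, smul_eq_mul, mul_left_comm _ k,
          ← Finset.mul_sum] }
  have hTapp : ∀ (x : E) n, T x n = (Real.sqrt (w n) : ℂ) * (c ⍟ A x) n := fun x n => rfl
  have hev : ∀ n, Continuous fun x : E => x n := fun n =>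
    (continuous_apply n).comp (lp.uniformContinuous_coe (p := 2)).continuous
  have hTc : ∀ n, Continuous fun x : E => T x n := fun n => by
    simp only [hTapp, LSeries.convolution_def]
    refine continuous_const.mul (continuous_finsetSum _ fun p _ => continuous_const.mul ?_)
    by_cases hn : p.2 < n₀
    · simp only [A, if_pos hn]; exact continuous_const
    · simp only [A, if_neg hn]; exact (hev _).div_const _
  -- The graph is closed since each coordinate of `T x` depends on finitely many coordinates of `x`,
  -- and limits in `ℓ²` are coordinatewise.
  let S : E →L[ℂ] E := ContinuousLinearMap.ofSeqClosedGraph (g := T) fun u x y hu hy => by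
    ext n
    exact tendsto_nhds_unique (((hev n).tendsto y).comp hy) (((hTc n).tendsto x).comp hu)
  refine ⟨‖S‖₊, fun a ha hs => ?_⟩
  let x : E := ⟨fun n => (Real.sqrt (w n) : ℂ) * a n, (hmem _).2 (by simpa only [hsq] using hs)⟩
  have hAx : A x = a := by
    funext n
    by_cases hn : n < n₀
    · rw [hA0 _ n hn, ha n hn]
    · have : (Real.sqrt (w n) : ℂ) ≠ 0 := by
        exact_mod_cast (Real.sqrt_pos.2 (hw n (not_lt.1 hn))).ne'
      simp only [A, if_neg hn, x]
      rw [mul_div_cancel_left₀ _ this]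
  have h1 : ‖S x‖ ^ 2 = ∑' n, ‖(c ⍟ a) n‖ ^ 2 * w n := by
    rw [hnorm]
    refine tsum_congr fun n => ?_
    rw [← hsq, ← hAx]; rfl
  have h2 : ‖x‖ ^ 2 = ∑' n, ‖a n‖ ^ 2 * w n := by
    rw [hnorm]
    exact tsum_congr fun n => hsq _ _
  rw [← h1, ← h2, coe_nnnorm, ← mul_pow]
  gcongr
  exact S.le_opNorm x

theorem convolution_eq_zero_of_lt {n₀ : ℕ} {a c : ℕ → ℂ} (ha : ∀ n < n₀, a n = 0) {n : ℕ}
    (hn : n < n₀) : (c ⍟ a) n = 0 := by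
  rw [LSeries.convolution_def]
  refine Finset.sum_eq_zero fun p hp => ?_
  rw [ha _ ((Nat.divisor_le (Nat.snd_mem_divisors_of_mem_antidiagonal hp)).trans_lt hn), mul_zero]

theorem convolution_congr_of_lt {N : ℕ} {a a' c : ℕ → ℂ} (ha : ∀ n < N, a n = a' n) {n : ℕ}
    (hn : n < N) : (c ⍟ a) n = (c ⍟ a') n := by
  simp only [LSeries.convolution_def]
  refine Finset.sum_congr rfl fun p hp => ?_
  rw [ha _ ((Nat.divisor_le (Nat.snd_mem_divisors_of_mem_antidiagonal hp)).trans_lt hn)]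

/-- The constant 1 is not in the space when `n₀ ≥ 2`, so `φ` is recovered from its products with
`n₀^{-s}` and `(n₀+1)^{-s}`. -/
theorem exists_isRepresentedBy_of_isMultiplier {n₀ : ℕ} {w : ℕ → ℝ} (hn₀ : 1 ≤ n₀)
    {φ : halfPlane (1 / 2) → ℂ} (hφ : IsMultiplier n₀ w φ) : ∃ c, IsRepresentedBy φ c := by
  have key : ∀ K ≥ n₀, ∃ b, IsRepresentedBy (npowNeg K * φ) b := by
    intro K hK
    have hK0 : K ≠ 0 := by omega
    have hδ : ∀ n, n ≠ K → dilate K LSeries.delta n = 0 := by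
      intro n hn
      by_cases h : K ∣ n
      · obtain ⟨m, rfl⟩ := h
        rw [dilate_mul hK0, LSeries.delta, if_neg]
        rintro rfl
        exact hn (mul_one K)
      · exact dilate_of_not_dvd h _
    have hmem : npowNeg K ∈ space n₀ w := by
      refine ⟨_, isRepresentedBy_npowNeg hK0, fun n hn => hδ n (by omega), ?_⟩
      refine summable_of_ne_finset_zero (s := {K}) fun n hn => ?_
      simp [hδ n (by simpa using hn)]
    obtain ⟨b, hb, -⟩ := hφ _ hmem
    exact ⟨b, by rwa [mul_comm]⟩
  obtain ⟨b, hb⟩ := key n₀ le_rfl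
  obtain ⟨b', hb'⟩ := key (n₀ + 1) (Nat.le_succ _)
  exact exists_isRepresentedBy_of_npowNeg_mul (by omega) hb hb'

theorem multiplierNorm_lt_top {n₀ : ℕ} {w : ℕ → ℝ} (hn₀ : 1 ≤ n₀) (hw0 : ∀ n, 0 ≤ w n)
    (hlow : ∀ ε > (0 : ℝ), ∃ c > (0 : ℝ), ∀ n ≥ n₀, c * (n : ℝ) ^ (-ε) ≤ w n)
    {φ : halfPlane (1 / 2) → ℂ} (hφ : IsMultiplier n₀ w φ) : multiplierNorm n₀ w φ < ⊤ := by
  obtain ⟨c, hc⟩ := exists_isRepresentedBy_of_isMultiplier hn₀ hφ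
  have hw : ∀ n ≥ n₀, 0 < w n := fun n hn => by
    obtain ⟨d, hd, h⟩ := hlow 1 one_pos
    have : (0 : ℝ) < n := by exact_mod_cast hn₀.trans hn
    exact lt_of_lt_of_le (by positivity) (h n hn)
  obtain ⟨C, hC⟩ := exists_convolution_bound (c := c) hw0 hw fun a h0 hs => by
    obtain ⟨f, hf, hfa⟩ := exists_mem_space_of_summable hn₀ hlow h0 hs
    exact ((hc.mul hfa).mem_space_iff.1 (hφ f hf)).2
  refine lt_of_le_of_lt (iInf₂_le C fun f hf => ?_) (ENNReal.coe_lt_top (r := C))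
  obtain ⟨a, ha, h0, hs⟩ := hf
  exact (spaceNorm_le_iff hw0 ha (hc.mul ha) C.2).2 (hC a h0 hs)

/-! ### Passage to unweighted truncations -/

/-- If multiplication by a Dirichlet series is bounded by `C` with respect to the weights
`(log n)² wₙ`, where `w` is antitone and decays slower than any power, then convolution by its
coefficients is bounded by `C` on unweighted truncations. -/
theorem partialSums_convolution_le {n₀ : ℕ} {w : ℕ → ℝ} (hn₀ : 2 ≤ n₀) (hw0 : ∀ n, 0 ≤ w n)
    (hanti : ∀ m ≥ n₀, ∀ n ≥ m, w n ≤ w m)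
    (hlow : ∀ ε > (0 : ℝ), ∃ c > (0 : ℝ), ∀ n ≥ n₀, c * (n : ℝ) ^ (-ε) ≤ w n / Real.log n ^ 2)
    {φ : halfPlane (1 / 2) → ℂ} {c : ℕ → ℂ} (hc : IsRepresentedBy φ c)
    (hφ : IsMultiplier n₀ (fun n => Real.log n ^ 2 * w n) φ) {C : ℝ≥0}
    (hC : ∀ f ∈ space n₀ (fun n => Real.log n ^ 2 * w n),
      spaceNorm (fun n => Real.log n ^ 2 * w n) (φ * f) ≤
        C * spaceNorm (fun n => Real.log n ^ 2 * w n) f)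
    {a : ℕ → ℂ} (h0 : ∀ n < n₀, a n = 0) (N : ℕ) :
    ∑ n ∈ Finset.range N, ‖(c ⍟ a) n‖ ^ 2 ≤ ∑ n ∈ Finset.range N, (C : ℝ) ^ 2 * ‖a n‖ ^ 2 := by
  set v : ℕ → ℝ := fun n => Real.log n ^ 2 * w n with hv
  have hv0 : ∀ n, 0 ≤ v n := fun n => mul_nonneg (sq_nonneg _) (hw0 n)
  rcases Nat.eq_zero_or_pos N with rfl | hN
  · simp
  rw [← Finset.mul_sum]
  -- The estimate obtained for each `K`, divided by `(log K)² (log KN)²`, has the form `A u(KN) ≤ B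
  -- u(K)` required here; this is why `u = w / log²`.
  refine not_contraction_of_subpolynomial (u := fun n => w n / Real.log n ^ 2) (by omega) hN hlow
    (by positivity) fun K hK => ?_
  have hK0 : K ≠ 0 := by omega
  have hdil : ∀ (b : ℕ → ℂ) (x : ℝ), HasSum (fun n => ‖dilate K b n‖ ^ 2 * v n) x ↔
      HasSum (fun n => ‖b n‖ ^ 2 * v (K * n)) x := fun b x => by
    rw [← hasSum_comp_dilate hK0]
    · simp only [dilate_mul hK0]
    · intro n hn
      simp [dilate_of_not_dvd hn]
  set a' : ℕ → ℂ := fun n => if n < N then a n else 0 with ha'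
  have ha'N : ∀ n < N, a n = a' n := fun n hn => by simp [ha', hn]
  have ha'0 : ∀ n < n₀, a' n = 0 := fun n hn => by simp [ha', h0 n hn]
  have hfin : ∀ n ∉ Finset.range N, a' n = 0 := fun n hn => if_neg (by simpa using hn)
  have hP : IsRepresentedBy (fun s => ∑ n ∈ Finset.range N, LSeries.term a' s n) a' := by
    refine ⟨ha'0 0 (by omega), fun s => hasSum_sum_of_ne_finset_zero fun n hn => ?_⟩
    simp [LSeries.term_def, hfin n hn]
  set P : halfPlane (1 / 2) → ℂ := fun s => ∑ n ∈ Finset.range N, LSeries.term a' s n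
  have hF := (isRepresentedBy_dilate hK0).2 hP
  have hG := (isRepresentedBy_dilate hK0).2 (hc.mul hP)
  rw [mul_left_comm] at hG
  have hsumF : HasSum (fun n => ‖a' n‖ ^ 2 * v (K * n))
      (∑ n ∈ Finset.range N, ‖a' n‖ ^ 2 * v (K * n)) :=
    hasSum_sum_of_ne_finset_zero fun n hn => by simp [hfin n hn]
  have hFmem : npowNeg K * P ∈ space n₀ v := by
    refine hF.mem_space_iff.2 ⟨fun n hn => ?_, ((hdil _ _).2 hsumF).summable⟩
    by_cases h : K ∣ n
    · obtain ⟨m, rfl⟩ := h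
      rw [dilate_mul hK0]
      exact ha'0 m ((Nat.le_mul_of_pos_left m (by omega)).trans_lt hn)
    · exact dilate_of_not_dvd h _
  have hle := (spaceNorm_le_iff hv0 hF hG C.2).1 (hC _ hFmem)
  have hsumG := (hdil _ _).1 (hG.mem_space_iff.1 (hφ _ hFmem)).2.hasSum
  rw [((hdil _ _).2 hsumF).tsum_eq] at hle
  have h1 := (sum_le_hasSum (Finset.range N) (fun n _ => mul_nonneg (by positivity) (hv0 _))
    hsumG).trans hle
  have hKr : (1 : ℝ) < K := by exact_mod_cast (by omega : 1 < K)
  have hNr : (1 : ℝ) ≤ N := by exact_mod_cast hN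
  have hlK : 0 < Real.log K := Real.log_pos hKr
  have hlKN : 0 < Real.log ((K * N : ℕ) : ℝ) := Real.log_pos (by
    push_cast; nlinarith)
  have hlower : (∑ n ∈ Finset.range N, ‖(c ⍟ a) n‖ ^ 2) * (Real.log K ^ 2 * w (K * N)) ≤
      ∑ n ∈ Finset.range N, ‖(c ⍟ a') n‖ ^ 2 * v (K * n) := by
    rw [Finset.sum_mul]
    refine Finset.sum_le_sum fun n hn => ?_
    have hnN := Finset.mem_range.1 hn
    rw [← convolution_congr_of_lt ha'N hnN]
    rcases Nat.eq_zero_or_pos n with rfl | hn0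
    · simp
    have hKn : K ≤ K * n := Nat.le_mul_of_pos_right K hn0
    have : w (K * N) ≤ w (K * n) := hanti _ (hK.trans hKn) _ (Nat.mul_le_mul_left K hnN.le)
    have hl : Real.log K ≤ Real.log ((K * n : ℕ) : ℝ) :=
      Real.log_le_log (by linarith) (by exact_mod_cast hKn)
    have := hw0 (K * N)
    simp only [hv]
    gcongr
  have hupper : ∑ n ∈ Finset.range N, ‖a' n‖ ^ 2 * v (K * n) ≤
      (∑ n ∈ Finset.range N, ‖a n‖ ^ 2) * (Real.log ((K * N : ℕ) : ℝ) ^ 2 * w K) := by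
    rw [Finset.sum_mul]
    refine Finset.sum_le_sum fun n hn => ?_
    have hnN := Finset.mem_range.1 hn
    rw [← ha'N n hnN]
    rcases Nat.eq_zero_or_pos n with rfl | hn0
    · simp [h0 0 (by omega)]
    have hKn : K ≤ K * n := Nat.le_mul_of_pos_right K hn0
    have : w (K * n) ≤ w K := hanti _ hK _ hKn
    have hpos : (0 : ℝ) < ((K * n : ℕ) : ℝ) := by exact_mod_cast Nat.mul_pos (by omega) hn0
    have hl0 : 0 ≤ Real.log ((K * n : ℕ) : ℝ) := Real.log_natCast_nonneg _
    have hl : Real.log ((K * n : ℕ) : ℝ) ≤ Real.log ((K * N : ℕ) : ℝ) :=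
      Real.log_le_log hpos (by exact_mod_cast Nat.mul_le_mul_left K hnN.le)
    have := hw0 (K * n)
    simp only [hv]
    gcongr
  have h2 : (∑ n ∈ Finset.range N, ‖(c ⍟ a) n‖ ^ 2) * (Real.log K ^ 2 * w (K * N)) ≤
      (C : ℝ) ^ 2 * ((∑ n ∈ Finset.range N, ‖a n‖ ^ 2) *
        (Real.log ((K * N : ℕ) : ℝ) ^ 2 * w K)) :=
    hlower.trans (h1.trans (mul_le_mul_of_nonneg_left hupper (by positivity)))
  rw [mul_div_assoc', mul_div_assoc', div_le_div_iff₀ (by positivity) (by positivity)]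
  linarith

/-! ### Growth of the moment weights -/

theorem integrable_weight {μ : Measure ℝ≥0} {n₀ n : ℕ} (hn₀ : 1 ≤ n₀)
    (hμ : Integrable (fun σ : ℝ≥0 => (n₀ : ℝ) ^ (-2 * (σ : ℝ))) μ) (hn : n₀ ≤ n) :
    Integrable (fun σ : ℝ≥0 => (n : ℝ) ^ (-2 * (σ : ℝ))) μ := by
  have h0 : (0 : ℝ) < n₀ := by exact_mod_cast hn₀
  have hn' : (n₀ : ℝ) ≤ n := by exact_mod_cast hn
  refine hμ.mono (Measurable.aestronglyMeasurable (by fun_prop)) (ae_of_all _ fun σ => ?_)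
  rw [Real.norm_of_nonneg (by positivity), Real.norm_of_nonneg (by positivity)]
  exact Real.rpow_le_rpow_of_nonpos h0 hn' (by have := σ.2; simp)

theorem weight_nonneg (μ : Measure ℝ≥0) (n : ℕ) : 0 ≤ weight μ n :=
  integral_nonneg fun _ => by positivity

theorem weight_anti {μ : Measure ℝ≥0} {n₀ : ℕ} (hn₀ : 1 ≤ n₀)
    (hμ : Integrable (fun σ : ℝ≥0 => (n₀ : ℝ) ^ (-2 * (σ : ℝ))) μ) {m n : ℕ} (hm : n₀ ≤ m)
    (hmn : m ≤ n) : weight μ n ≤ weight μ m := by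
  have h0 : (0 : ℝ) < m := by exact_mod_cast hn₀.trans hm
  exact integral_mono (integrable_weight hn₀ hμ (hm.trans hmn)) (integrable_weight hn₀ hμ hm)
    fun σ => Real.rpow_le_rpow_of_nonpos h0 (by exact_mod_cast hmn) (by simp)

/-- On `[0, ε/2]` the integrand is at least `n^{-ε}`, and this interval has positive finite mass,
which serves as `c`. -/
theorem weight_lower_bound {μ : Measure ℝ≥0} [IsLocallyFiniteMeasure μ] {n₀ : ℕ} (hn₀ : 2 ≤ n₀)
    (hμ : Integrable (fun σ : ℝ≥0 => (n₀ : ℝ) ^ (-2 * (σ : ℝ))) μ)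
    (hsupp : (0 : ℝ≥0) ∈ μ.support) {ε : ℝ} (hε : 0 < ε) :
    ∃ c > (0 : ℝ), ∀ n ≥ n₀, c * (n : ℝ) ^ (-ε) ≤ weight μ n := by
  set η : ℝ≥0 := ⟨ε / 2, by positivity⟩
  have hη0 : 0 < η := by rw [← NNReal.coe_pos]; exact half_pos hε
  have hpos : 0 < μ (Set.Iic η) := (Measure.mem_support_iff_forall 0).1 hsupp _ (Iic_mem_nhds hη0)
  have hfin : μ (Set.Iic η) < ⊤ := by
    rw [← Set.Icc_bot]
    exact isCompact_Icc.measure_lt_top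
  refine ⟨μ.real (Set.Iic η), ENNReal.toReal_pos hpos.ne' hfin.ne, fun n hn => ?_⟩
  have hn1 : (1 : ℝ) < n := by exact_mod_cast (by omega : 1 < n)
  have h := mul_meas_ge_le_integral_of_nonneg (μ := μ)
    (ae_of_all _ fun σ : ℝ≥0 => (by positivity : (0 : ℝ) ≤ (n : ℝ) ^ (-2 * (σ : ℝ))))
    (integrable_weight (by omega) hμ hn) ((n : ℝ) ^ (-ε))
  have hset : {σ : ℝ≥0 | (n : ℝ) ^ (-ε) ≤ (n : ℝ) ^ (-2 * (σ : ℝ))} = Set.Iic η := by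
    ext σ
    rw [Set.mem_ofPred_eq, Real.rpow_le_rpow_left_iff hn1, Set.mem_Iic, ← NNReal.coe_le_coe]
    change _ ↔ (σ : ℝ) ≤ ε / 2
    constructor <;> intro <;> linarith
  rw [hset, mul_comm] at h
  exact h

theorem div_log_sq_lower_bound {n₀ : ℕ} (hn₀ : 2 ≤ n₀) {w : ℕ → ℝ}
    (hlow : ∀ ε > (0 : ℝ), ∃ c > (0 : ℝ), ∀ n ≥ n₀, c * (n : ℝ) ^ (-ε) ≤ w n) {ε : ℝ}
    (hε : 0 < ε) :
    ∃ c > (0 : ℝ), ∀ n ≥ n₀, c * (n : ℝ) ^ (-ε) ≤ w n / Real.log n ^ 2 := by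
  obtain ⟨c, hc, h⟩ := hlow (ε / 2) (by positivity)
  -- From `log n ≤ n^{ε/4} / (ε/4)`; squaring costs `n^{ε/2}`, the half of `ε` left over.
  refine ⟨c * (ε / 4) ^ 2, by positivity, fun n hn => ?_⟩
  have hn1 : (1 : ℝ) < n := by exact_mod_cast (by omega : 1 < n)
  have hn0 : (0 : ℝ) < n := by linarith
  have hl := Real.log_pos hn1
  have hlog := Real.log_le_rpow_div hn0.le (by positivity : 0 < ε / 4)
  rw [le_div_iff₀ (by positivity)] at hlog ⊢
  have h2 : (Real.log n * (ε / 4)) ^ 2 ≤ (n : ℝ) ^ (ε / 2) := by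
    calc _ ≤ ((n : ℝ) ^ (ε / 4)) ^ 2 := by gcongr
      _ = _ := by
        rw [← Real.rpow_natCast, ← Real.rpow_mul hn0.le]
        congr 1
        push_cast
        ring
  calc _ = c * (n : ℝ) ^ (-ε) * (Real.log n * (ε / 4)) ^ 2 := by ring
    _ ≤ c * (n : ℝ) ^ (-ε) * (n : ℝ) ^ (ε / 2) := by gcongr
    _ = c * (n : ℝ) ^ (-(ε / 2)) := by
        rw [mul_assoc, ← Real.rpow_add hn0]
        congr 2
        ring
    _ ≤ _ := h n hn

theorem log_sq_mul_lower_bound {n₀ : ℕ} (hn₀ : 2 ≤ n₀) {w : ℕ → ℝ}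
    (hlow : ∀ ε > (0 : ℝ), ∃ c > (0 : ℝ), ∀ n ≥ n₀, c * (n : ℝ) ^ (-ε) ≤ w n) {ε : ℝ}
    (hε : 0 < ε) :
    ∃ c > (0 : ℝ), ∀ n ≥ n₀, c * (n : ℝ) ^ (-ε) ≤ Real.log n ^ 2 * w n := by
  obtain ⟨c, hc, h⟩ := hlow ε hε
  have hl2 : 0 < Real.log 2 := Real.log_pos one_lt_two
  refine ⟨Real.log 2 ^ 2 * c, by positivity, fun n hn => ?_⟩
  have hl : Real.log 2 ≤ Real.log n :=
    Real.log_le_log two_pos (by exact_mod_cast hn₀.trans hn)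
  rw [mul_assoc]
  have := h n hn
  gcongr

end DirichletHilbert

theorem mainTheorem3 (μ : MeasureTheory.Measure ℝ≥0) [MeasureTheory.IsLocallyFiniteMeasure μ]
    (n₀ : ℕ) (hn₀ : 2 ≤ n₀)
    (hμ : MeasureTheory.Integrable (fun σ : ℝ≥0 => (n₀ : ℝ) ^ (-2 * (σ : ℝ))) μ)
    (hsupp : (0 : ℝ≥0) ∈ μ.support)
    (φ : DirichletHilbert.halfPlane (1 / 2) → ℂ)
    (hφ : DirichletHilbert.IsMultiplier n₀ (DirichletHilbert.weightFlat μ) φ) :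
    DirichletHilbert.IsMultiplier n₀ (DirichletHilbert.weight μ) φ ∧
      DirichletHilbert.multiplierNorm n₀ (DirichletHilbert.weightFlat μ) φ < ⊤ ∧
      DirichletHilbert.multiplierNorm n₀ (DirichletHilbert.weight μ) φ ≤
        DirichletHilbert.multiplierNorm n₀ (DirichletHilbert.weightFlat μ) φ := by
  open DirichletHilbert in
  have hn₁ : 1 ≤ n₀ := by omega
  have hw0 := weight_nonneg μ
  have hlow : ∀ ε > (0 : ℝ), ∃ c > (0 : ℝ), ∀ n ≥ n₀, c * (n : ℝ) ^ (-ε) ≤ weight μ n :=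
    fun ε hε => weight_lower_bound hn₀ hμ hsupp hε
  have hfin : multiplierNorm n₀ (weightFlat μ) φ < ⊤ :=
    multiplierNorm_lt_top hn₁ (fun n => mul_nonneg (sq_nonneg _) (hw0 n))
      (fun ε hε => log_sq_mul_lower_bound hn₀ hlow hε) hφ
  obtain ⟨c, hc⟩ := exists_isRepresentedBy_of_isMultiplier hn₁ hφ
  have key : ∀ C : ℝ≥0, (∀ f ∈ space n₀ (weightFlat μ),
      spaceNorm (weightFlat μ) (φ * f) ≤ C * spaceNorm (weightFlat μ) f) →
      ∀ f ∈ space n₀ (weight μ), φ * f ∈ space n₀ (weight μ) ∧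
        spaceNorm (weight μ) (φ * f) ≤ C * spaceNorm (weight μ) f := by
    rintro C hC f ⟨a, ha, h0, hs⟩
    have hps := partialSums_convolution_le hn₀ hw0
      (fun m hm n hn => weight_anti hn₁ hμ hm hn)
      (fun ε hε => div_log_sq_lower_bound hn₀ hlow hε) hc hφ hC h0
    have hb0 : ∀ n < n₀, LSeries.convolution c a n = 0 :=
      fun n hn => convolution_eq_zero_of_lt h0 hn
    -- Monotonicity of the weight is only available from `n₀` on, so it is frozen below `n₀`, where
    -- the coefficients vanish.
    have hmax : ∀ b : ℕ → ℂ, (∀ n < n₀, b n = 0) →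
        (fun n => ‖b n‖ ^ 2 * weight μ n) = fun n => ‖b n‖ ^ 2 * weight μ (max n n₀) := by
      intro b hb
      funext n
      rcases lt_or_ge n n₀ with hn | hn
      · simp [hb n hn]
      · rw [max_eq_left hn]
    rw [hmax a h0] at hs
    have hmain := summable_and_tsum_le_of_partialSums_le (W := fun n => weight μ (max n n₀))
      (fun m n hmn => weight_anti hn₁ hμ (le_max_right m n₀) (max_le_max_right n₀ hmn))
      (fun n => hw0 _) (fun n => by positivity) (fun n => by positivity) hps
      (by simpa only [mul_assoc] using hs.mul_left ((C : ℝ) ^ 2))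
    simp only [mul_assoc, tsum_mul_left] at hmain
    rw [← hmax _ hb0, ← hmax a h0] at hmain
    exact ⟨(hc.mul ha).mem_space_iff.2 ⟨hb0, hmain.1⟩,
      (spaceNorm_le_iff hw0 ha (hc.mul ha) C.2).2 hmain.2⟩
  refine ⟨fun f hf => ?_, hfin, ?_⟩
  · obtain ⟨C, hC⟩ := iInf_lt_iff.1 hfin
    obtain ⟨hC, -⟩ := iInf_lt_iff.1 hC
    exact (key C hC f hf).1
  · exact le_iInf₂ fun C hC => iInf₂_le C fun f hf => (key C hC f hf).2
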